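/- For $n\ge 1$ call a permutation $\sigma=[\sigma_1,\dots,\sigma_n]\in S_n$ a cylindrical king if $|\sigma_i-\sigma_{i+1}|>1$ for $1\le i\le n-1$ and, when $n\ge 2$, also $|\sigma_1-\sigma_n|>1$; let $CK_n$ be the set of cylindrical kings in $S_n$ (so $CK_1=S_1$). For $\pi\in S_n$ let $\mathrm{cbnd}(\pi)$ be the number of $i\in\{1,\dots,n\}$ with $|\pi_i-\pi_{i+1}|=1$, where $\pi_{n+1}=\pi_1$. Put $$CK(z)=\sum_{n\ge1}|CK_n|z^n,\qquad H(z,u)=\sum_{n\ge1}\sum_{\pi\in S_n}u^{\mathrm{cbnd}(\pi)}z^n .$$ Then $CK(z)=H(z,0)$, and, as formal power series, $$CK(z)=2z^2+\sum_{m\ge1}m!\,z^{m-1}\left(\frac{1-z}{1+z}\right)^{m-1}\cdot\frac{z\,(1-2z-z^2)}{(1+z)^2},$$ where the infinite sum converges coefficientwise. -/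

import Mathlib

open scoped PowerSeries.WithPiTopology

/-- The finset `CK_n` of cylindrical king permutations of `n` letters (positions and values are
numbered from `0`): entries in consecutive positions, and the entries in the first and the last
position, differ by more than one.  The requirement `i ≠ j` in the second condition only matters
for `n = 1`, where the first and the last entry are the same entry: `CK_1 = S_1`. -/
def cylindricalKings (n : ℕ) : Finset (Equiv.Perm (Fin n)) :=
  Finset.univ.filter fun σ =>
    (∀ i j : Fin n, i.val + 1 = j.val → 1 < |((σ i).val : ℤ) - ((σ j).val : ℤ)|) ∧
    (∀ i j : Fin n, i.val = 0 → j.val + 1 = n → i ≠ j →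
      1 < |((σ i).val : ℤ) - ((σ j).val : ℤ)|)

/-- The number `cbnd π` of cyclic bonds of `π`: the number of positions `i` such that the entry in
position `i` and the entry in the cyclically next position differ by exactly one.  Both
permutations of two letters have two cyclic bonds; the one of one letter has none. -/
def cyclicBondCount {n : ℕ} (π : Equiv.Perm (Fin n)) : ℕ :=
  (Finset.univ.filter fun i : Fin n =>
    |((π i).val : ℤ) - ((π (finRotate n i)).val : ℤ)| = 1).card

/-- `H(z, u) = ∑_{n ≥ 1} ∑_{π ∈ S_n} u ^ cbnd(π) z ^ n`, as a power series in `z` whose coefficients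
are polynomials in `u`. -/
noncomputable def cyclicBondSeries : PowerSeries (Polynomial ℤ) :=
  PowerSeries.mk fun n =>
    if n = 0 then 0
    else ∑ π : Equiv.Perm (Fin n), (Polynomial.X : Polynomial ℤ) ^ cyclicBondCount π

/-- `CK(z) = ∑_{n ≥ 1} |CK_n| z ^ n`. -/
noncomputable def cylindricalKingSeries : PowerSeries ℤ :=
  PowerSeries.mk fun n => if n = 0 then 0 else ((cylindricalKings n).card : ℤ)

/-- The formal power series `1 / (1 + z)`. -/
noncomputable def invOneAddZ : PowerSeries ℤ :=
  PowerSeries.invOfUnit (1 + PowerSeries.X) 1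

theorem one_add_X_mul_invOneAddZ : (1 + PowerSeries.X) * invOneAddZ = 1 :=
  PowerSeries.mul_invOfUnit _ _ (by simp)

/-- The term of index `m` (for `m ≥ 1`) of the series for `CK(z)`:
`m! z ^ (m - 1) ((1 - z) / (1 + z)) ^ (m - 1) * (z (1 - 2 z - z ^ 2) / (1 + z) ^ 2)`. -/
noncomputable def cylindricalKingTerm (m : ℕ) : PowerSeries ℤ :=
  (m.factorial : PowerSeries ℤ) * PowerSeries.X ^ (m - 1) *
    ((1 - PowerSeries.X) * invOneAddZ) ^ (m - 1) *
    (PowerSeries.X * (1 - 2 * PowerSeries.X - PowerSeries.X ^ 2) * invOneAddZ ^ 2)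

/-!
A word `π` of `n ≥ 2` letters, read cyclically, has the successor map `c = π * finRotate n * π⁻¹`,
a full cycle, and every full cycle comes from exactly `n` words (`sum_conj_finRotate`).  Whether `π`
is a cylindrical king depends only on `c`: no letter may be mapped to a letter differing from it by
one.  Hence `|CK_n|` is `n` times the number of such full cycles.

For `n ≥ 3`, these cycles are counted by the product over all pairs of letters `v, v + 1` of
`1 - [c v = v + 1] - [c (v + 1) = v]`.  Expanding it gives a signed sum over full cycles with a
marking of some pairs, each by the direction in which `c` traverses it (`sum_follows_eq_prod`).
The marked pairs cut the letters into intervals, the blocks.  Deleting the letter `0` from the cycle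
makes this sum satisfy a recursion (`markedSum_succ_startsUnmarked`,
`markedSum_succ_not_startsUnmarked`): if `0` is a block of its own, it can be inserted in front of
any of the blocks, and otherwise it is joined to the block of `1`, on one side or on either.

With `W = X (1 - X) / (1 + X)`, the recursion is solved by `∑ (m - 1)! [X ^ n] W ^ m`
(`markedSum_startsUnmarked_and_not`), and `n (m - 1)! [X ^ n] W ^ m` is the coefficient of `X ^ n`
in `(m - 1)! X (W ^ m)' = m! X W' W ^ (m - 1)`, the term of index `m` of the series
(`cylindricalKingTerm_succ`).  For `n = 2` the two pairs of positions carry the same bond, which the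
expansion subtracts twice; the summand `2 X ^ 2` makes up for this.
-/

/-! ### Full cycles and cyclic words -/

/-- A permutation is a full cycle if all points lie on a single orbit. -/
def IsFullCycle {α : Type*} (c : Equiv.Perm α) : Prop := ∀ x y, c.SameCycle x y

/-- Insert the letter `0` into a permutation of `Fin n`, viewed as a disjoint union of directed
cycles on the letters `1, …, n`, so that `0` has successor `q.succ`. -/
def insertZero {n : ℕ} (q : Fin n) (e : Equiv.Perm (Fin n)) : Equiv.Perm (Fin (n + 1)) :=
  Equiv.Perm.decomposeFin.symm (q.succ, e)

theorem insertZero_zero {n : ℕ} (q : Fin n) (e : Equiv.Perm (Fin n)) :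
    insertZero q e 0 = q.succ := by
  simp [insertZero]

theorem insertZero_succ {n : ℕ} (q : Fin n) (e : Equiv.Perm (Fin n)) (x : Fin n) :
    insertZero q e x.succ = if e x = q then 0 else (e x).succ := by
  rw [insertZero, Equiv.Perm.decomposeFin_symm_apply_succ]
  split_ifs with h
  · simp [h]
  · exact Equiv.swap_apply_of_ne_of_ne (Fin.succ_ne_zero _) (by simpa using h)

theorem isFullCycle_insertZero_iff {n : ℕ} (q : Fin n) (e : Equiv.Perm (Fin n)) :
    IsFullCycle (insertZero q e) ↔ IsFullCycle e := by
  constructor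
  · intro h
    -- Project `Fin (n + 1)` to `Fin n` by contracting `0` onto its successor.
    let g : Fin (n + 1) → Fin n := Fin.cases q id
    have step : ∀ z, e.SameCycle (g z) (g (insertZero q e z)) := by
      intro z
      refine Fin.cases ?_ (fun x => ?_) z
      · rw [insertZero_zero]
        exact Equiv.Perm.SameCycle.refl _ _
      · rw [insertZero_succ]
        have hx : e.SameCycle x (e x) := (Equiv.Perm.sameCycle_apply_right).2 (.refl _ _)
        split_ifs with hq
        · change e.SameCycle x q
          rwa [← hq]
        · exact hx
    have iter : ∀ (k : ℕ) z, e.SameCycle (g z) (g ((insertZero q e ^ k) z)) := by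
      intro k
      induction k with
      | zero => intro z; exact .refl _ _
      | succ k ih =>
        intro z
        rw [pow_succ', Equiv.Perm.mul_apply]
        exact (ih z).trans (step _)
    intro x y
    obtain ⟨k, hk⟩ := (h x.succ y.succ).exists_nat_pow_eq
    simpa [hk, g] using iter k x.succ
  · intro h
    have step : ∀ x, (insertZero q e).SameCycle x.succ (e x).succ := by
      intro x
      by_cases hq : e x = q
      · have h1 : insertZero q e (insertZero q e x.succ) = (e x).succ := by
          rw [insertZero_succ, if_pos hq, insertZero_zero, hq]
        rw [← h1, Equiv.Perm.sameCycle_apply_right, Equiv.Perm.sameCycle_apply_right]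
      · have h1 : insertZero q e x.succ = (e x).succ := by
          rw [insertZero_succ, if_neg hq]
        rw [← h1, Equiv.Perm.sameCycle_apply_right]
    have iter : ∀ (k : ℕ) x, (insertZero q e).SameCycle x.succ ((e ^ k) x).succ := by
      intro k
      induction k with
      | zero => intro z; exact .refl _ _
      | succ k ih =>
        intro z
        rw [pow_succ', Equiv.Perm.mul_apply]
        exact (ih z).trans (step _)
    have key : ∀ x, (insertZero q e).SameCycle q.succ x := by
      intro x
      refine Fin.cases ?_ (fun x => ?_) x
      · rw [← insertZero_zero q e, Equiv.Perm.sameCycle_apply_left]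
      · obtain ⟨k, hk⟩ := (h q x).exists_nat_pow_eq
        simpa [hk] using iter k q
    exact fun x y => (key x).symm.trans (key y)

open Classical in
/-- The full cycles on the letters `0, …, n - 1`. -/
noncomputable def fullCycles (n : ℕ) : Finset (Equiv.Perm (Fin n)) :=
  Finset.univ.filter IsFullCycle

theorem mem_fullCycles {n : ℕ} {c : Equiv.Perm (Fin n)} : c ∈ fullCycles n ↔ IsFullCycle c := by
  simp [fullCycles]

/-- Every full cycle on `n + 2` letters arises exactly once by inserting `0` into a full cycle on
the other letters. -/
theorem sum_fullCycles_succ {M : Type*} [AddCommMonoid M] (n : ℕ)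
    (f : Equiv.Perm (Fin (n + 2)) → M) :
    ∑ c ∈ fullCycles (n + 2), f c = ∑ e ∈ fullCycles (n + 1), ∑ q, f (insertZero q e) := by
  classical
  rw [fullCycles, Finset.sum_filter, ← Equiv.sum_comp Equiv.Perm.decomposeFin.symm,
    Fintype.sum_prod_type_right, fullCycles, Finset.sum_filter]
  refine Finset.sum_congr rfl fun e _ => ?_
  rw [Fin.sum_univ_succ, if_neg, zero_add]
  · split_ifs with h
    · exact Finset.sum_congr rfl fun q _ => if_pos ((isFullCycle_insertZero_iff q e).2 h)
    · exact Finset.sum_eq_zero fun q _ => if_neg (mt (isFullCycle_insertZero_iff q e).1 h)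
  · intro h
    exact zero_ne_one ((h 0 1).eq_of_left (by simp [Function.IsFixedPt]))

theorem isConj_finRotate_iff {n : ℕ} (c : Equiv.Perm (Fin (n + 2))) :
    IsConj (finRotate (n + 2)) c ↔ IsFullCycle c := by
  constructor
  · intro h
    obtain ⟨π, rfl⟩ := isConj_iff.1 h
    have h0 : ∀ x, (finRotate (n + 2)) x ≠ x := fun x => by
      rw [← Equiv.Perm.mem_support, support_finRotate]; simp
    intro x y
    rw [Equiv.Perm.sameCycle_conj]
    exact isCycle_finRotate.sameCycle (h0 _) (h0 _)
  · intro h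
    have hne : ∀ x, c x ≠ x := by
      intro x hx
      obtain ⟨y, hy⟩ := exists_ne x
      exact hy (((h x y).eq_of_left hx).symm)
    have hc : c.IsCycle := ⟨0, hne 0, fun y _ => h 0 y⟩
    have hs : c.support = Finset.univ := by
      ext x; simp [hne x]
    rw [Equiv.Perm.isConj_iff_cycleType_eq, isCycle_finRotate.cycleType, hc.cycleType, hs,
      support_finRotate]

theorem card_conj_eq_finRotate {n : ℕ} {c : Equiv.Perm (Fin (n + 2))} (hc : IsFullCycle c) :
    (Finset.univ.filter fun π : Equiv.Perm (Fin (n + 2)) =>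
      π * finRotate (n + 2) * π⁻¹ = c).card = n + 2 := by
  obtain ⟨π₀, rfl⟩ := isConj_iff.1 ((isConj_finRotate_iff c).2 hc)
  have h := Equiv.Perm.nat_card_centralizer (finRotate (n + 2))
  rw [isCycle_finRotate.cycleType, support_finRotate] at h
  simp only [Finset.card_univ, Fintype.card_fin] at h
  have h2 : Nat.card (Subgroup.centralizer {finRotate (n + 2)}) = n + 2 := by
    rw [h]; simp
  refine Eq.trans ?_ h2
  rw [← Fintype.card_subtype, ← Nat.card_eq_fintype_card]
  refine Nat.card_congr ((Equiv.mulLeft π₀⁻¹).subtypeEquiv fun π => ?_)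
  rw [Subgroup.mem_centralizer_singleton_iff, Equiv.coe_mulLeft]
  constructor
  · intro h
    rw [mul_inv_eq_iff_eq_mul] at h
    rw [mul_assoc, h]
    group
  · intro h
    have h' := congrArg (fun σ => π₀ * σ) h
    simp only [← mul_assoc, mul_inv_cancel, one_mul] at h'
    rw [h', mul_inv_cancel_right]

/-- Each full cycle on `n + 2` letters is the successor map of exactly `n + 2` words, the rotations
of one of them. -/
theorem sum_conj_finRotate {n : ℕ} (f : Equiv.Perm (Fin (n + 2)) → ℤ) :
    ∑ π, f (π * finRotate (n + 2) * π⁻¹) = (n + 2) * ∑ c ∈ fullCycles (n + 2), f c := by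
  rw [Finset.mul_sum, ← Finset.sum_fiberwise_of_maps_to
    (g := fun π => π * finRotate (n + 2) * π⁻¹) (t := fullCycles (n + 2))
    (fun π _ => mem_fullCycles.2 ((isConj_finRotate_iff _).1 (isConj_iff.2 ⟨π, rfl⟩)))]
  refine Finset.sum_congr rfl fun c hc => ?_
  rw [Finset.sum_congr rfl (g := fun _ => f c)
    (fun π hπ => by rw [(Finset.mem_filter.1 hπ).2]), Finset.sum_const,
    card_conj_eq_finRotate (mem_fullCycles.1 hc)]
  simp

theorem fullCycles_one : fullCycles 1 = Finset.univ := by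
  ext c
  simp only [mem_fullCycles, Finset.mem_univ, iff_true]
  intro x y
  rw [Subsingleton.elim x y]

/-! ### Full cycles with marked pairs of consecutive letters -/

/-- A marking `d` of the pairs of consecutive letters `v, v + 1` is followed by the permutation `c`
if `c` maps `v` to `v + 1` whenever `d v = 1`, and `v + 1` to `v` whenever `d v = -1`.  The pairs
with `d v = 0` are unmarked. -/
def Follows {n : ℕ} (c : Equiv.Perm (Fin (n + 1))) (d : Fin n → SignType) : Prop :=
  ∀ v, (d v = 1 → c v.castSucc = v.succ) ∧ (d v = -1 → c v.succ = v.castSucc)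

/-- The letter `q` is not the head of an arc prescribed by the marking `d`. -/
def Avoids {n : ℕ} (q : Fin (n + 1)) (d : Fin n → SignType) : Prop :=
  ∀ v, (d v = 1 → v.succ ≠ q) ∧ (d v = -1 → v.castSucc ≠ q)

/-- The number of intervals into which the unmarked pairs cut the letters `0, …, n`. -/
def blockCount {n : ℕ} (d : Fin n → SignType) : ℕ :=
  (Finset.univ.filter fun v => d v = 0).card + 1

/-- The factor `-1` for a marked pair and `1` for an unmarked one. -/
def markSign (s : SignType) : ℤ := if s = 0 then 1 else -1

/-- The marking leaves the pair `0, 1` unmarked, or there is no such pair. -/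
def StartsUnmarked {n : ℕ} (d : Fin n → SignType) : Prop := ∀ v, v.val = 0 → d v = 0

instance {n : ℕ} (c : Equiv.Perm (Fin (n + 1))) : DecidablePred (Follows c) := fun d => by
  unfold Follows; infer_instance

instance {n : ℕ} (d : Fin n → SignType) : DecidablePred fun q => Avoids q d := fun q => by
  unfold Avoids; infer_instance

instance {n : ℕ} : DecidablePred fun d : Fin n → SignType => StartsUnmarked d := fun d => by
  unfold StartsUnmarked; infer_instance

theorem insertZero_succ_eq_succ_iff {n : ℕ} {q : Fin n} {e : Equiv.Perm (Fin n)} {x y : Fin n} :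
    insertZero q e x.succ = y.succ ↔ e x = y ∧ y ≠ q := by
  rw [insertZero_succ]
  split_ifs with h
  · simp only [(Fin.succ_ne_zero y).symm, false_iff, not_and, not_not]
    exact fun h' => h' ▸ h
  · rw [Fin.succ_inj]
    exact ⟨fun h' => ⟨h', h' ▸ h⟩, And.left⟩

theorem follows_insertZero_cons_iff {n : ℕ} {q : Fin (n + 1)} {e : Equiv.Perm (Fin (n + 1))}
    {s : SignType} {d : Fin n → SignType} :
    Follows (insertZero q e) (Fin.cons s d : Fin (n + 1) → SignType) ↔
      (Follows e d ∧ Avoids q d) ∧ (s = 1 → q = 0) ∧ (s = -1 → e 0 = q) := by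
  have h0 : insertZero q e (Fin.succ 0) = 0 ↔ e 0 = q := by
    rw [insertZero_succ]; split_ifs with h <;> simp [h, Fin.succ_ne_zero]
  simp only [Follows, Avoids]
  rw [Fin.forall_fin_succ]
  simp only [Fin.cons_zero, Fin.cons_succ, Fin.castSucc_zero, insertZero_zero, Fin.succ_inj, h0,
    ← Fin.succ_castSucc, insertZero_succ_eq_succ_iff]
  grind

/-- The heads of the arcs prescribed by a marking which a permutation follows are distinct, so the
number of other letters is the number of blocks. -/
theorem card_avoids {n : ℕ} {e : Equiv.Perm (Fin (n + 1))} {d : Fin n → SignType}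
    (h : Follows e d) : (Finset.univ.filter fun q => Avoids q d).card = blockCount d := by
  let t : Fin n → Fin (n + 1) := fun v => if d v = 1 then v.succ else v.castSucc
  have hd : ∀ v, d v ≠ 0 → d v = 1 ∨ d v = -1 := fun v => by
    generalize d v = s; revert s; decide
  have hinj : Set.InjOn t (Finset.univ.filter fun v => d v ≠ 0) := by
    intro v hv w hw hvw
    have hv' := hd v (by simpa using hv)
    have hw' := hd w (by simpa using hw)
    have key : ∀ v w, d v = 1 → d w = -1 → v.succ ≠ w.castSucc := by
      intro v w hv hw hvw
      have h1 := (h v).1 hv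
      rw [hvw, ← (h w).2 hw] at h1
      have h2 := congrArg Fin.val (e.injective h1)
      have h3 := congrArg Fin.val hvw
      simp at h2 h3
      omega
    simp only [t] at hvw
    rcases hv' with hv' | hv' <;> rcases hw' with hw' | hw' <;> simp [hv', hw'] at hvw
    · exact hvw
    · exact absurd hvw (key v w hv' hw')
    · exact absurd hvw.symm (key w v hw' hv')
    · exact hvw
  have hcompl : (Finset.univ.filter fun q => Avoids q d) =
      ((Finset.univ.filter fun v => d v ≠ 0).image t)ᶜ := by
    ext q
    simp only [Finset.mem_filter, Finset.mem_univ, true_and, Finset.mem_compl, Finset.mem_image,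
      not_exists, not_and, t]
    refine forall_congr' fun v => ?_
    generalize d v = s
    revert s
    rintro (_ | _ | _) <;> simp
  rw [hcompl, Finset.card_compl, Finset.card_image_of_injOn hinj, Fintype.card_fin, blockCount]
  have := Finset.card_filter_add_card_filter_not (s := (Finset.univ : Finset (Fin n)))
    (fun v => d v = 0)
  rw [Finset.card_univ, Fintype.card_fin] at this
  simp only [ne_eq]
  omega

theorem avoids_zero_iff {n : ℕ} {d : Fin n → SignType} :
    Avoids 0 d ↔ ∀ v, v.val = 0 → d v ≠ -1 := by
  refine forall_congr' fun v => ?_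
  simp [Fin.ext_iff]
  tauto

theorem avoids_apply_zero_iff {n : ℕ} {e : Equiv.Perm (Fin (n + 1))} {d : Fin n → SignType}
    (h : Follows e d) : Avoids (e 0) d ↔ ∀ v, v.val = 0 → d v ≠ 1 := by
  refine forall_congr' fun v => ?_
  have h1 : d v = -1 → v.castSucc ≠ e 0 := fun hv => by
    rw [← (h v).2 hv]
    simp
  have h2 : d v = 1 → (v.succ = e 0 ↔ v.val = 0) := fun hv => by
    rw [← (h v).1 hv, e.injective.eq_iff]
    simp [Fin.ext_iff]
  grind

/-- The successor of `0` can be chosen in two ways when a pair `0, 1` is to be marked in front of a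
marking with an unmarked first pair, and in one way otherwise. -/
theorem avoids_zero_add_avoids_apply_zero {n : ℕ} {e : Equiv.Perm (Fin (n + 1))}
    {d : Fin n → SignType} (h : Follows e d) :
    ((if Avoids 0 d then 1 else 0) + if Avoids (e 0) d then 1 else 0 : ℤ) =
      if StartsUnmarked d then 2 else 1 := by
  cases n with
  | zero => simp [Avoids, StartsUnmarked]
  | succ n =>
    have : ∀ p : SignType → Prop, (∀ v : Fin (n + 1), v.val = 0 → p (d v)) ↔ p (d 0) := fun p =>
      ⟨fun h => h 0 rfl, fun h v hv => by rwa [show v = 0 from Fin.ext hv]⟩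
    have h1 := avoids_zero_iff.trans (this (· ≠ -1))
    have h2 := (avoids_apply_zero_iff h).trans (this (· ≠ 1))
    have h3 : StartsUnmarked d ↔ d 0 = 0 := this (· = 0)
    simp only [h1, h2, h3]
    clear h1 h2 h3
    generalize d 0 = s
    revert s
    decide

theorem blockCount_cons {n : ℕ} (s : SignType) (d : Fin n → SignType) :
    blockCount (Fin.cons s d : Fin (n + 1) → SignType) =
      blockCount d + if s = 0 then 1 else 0 := by
  rw [blockCount, blockCount, Finset.card_filter, Finset.card_filter, Fin.sum_univ_succ]
  simp only [Fin.cons_zero, Fin.cons_succ]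
  ring

theorem startsUnmarked_cons {n : ℕ} (s : SignType) (d : Fin n → SignType) :
    StartsUnmarked (Fin.cons s d : Fin (n + 1) → SignType) ↔ s = 0 :=
  ⟨fun h => h 0 rfl, fun h v hv => by rw [show v = 0 from Fin.ext hv]; exact h⟩

/-- The signed sum of `f (number of blocks)` over all pairs of a full cycle on `n + 1` letters and a
marking that it follows, restricted to the markings that satisfy `p`. -/
noncomputable def markedSum (n : ℕ) (p : (Fin n → SignType) → Prop) [DecidablePred p]
    (f : ℕ → ℤ) : ℤ :=
  ∑ c ∈ fullCycles (n + 1), ∑ d, if Follows c d ∧ p d then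
    (∏ v, markSign (d v)) * f (blockCount d) else 0

theorem markedSum_add_not (n : ℕ) (p : (Fin n → SignType) → Prop) [DecidablePred p] (f : ℕ → ℤ) :
    markedSum n p f + markedSum n (fun d => ¬ p d) f = markedSum n (fun _ => True) f := by
  simp only [markedSum, ← Finset.sum_add_distrib]
  refine Finset.sum_congr rfl fun c _ => Finset.sum_congr rfl fun d _ => ?_
  by_cases h : p d <;> simp [h]

theorem markedSum_succ (n : ℕ) (p : (Fin (n + 1) → SignType) → Prop) [DecidablePred p]
    (f : ℕ → ℤ) :
    markedSum (n + 1) p f = ∑ e ∈ fullCycles (n + 1), ∑ d : Fin n → SignType, ∑ s : SignType,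
      ∑ q, if Follows (insertZero q e) (Fin.cons s d : Fin (n + 1) → SignType) ∧ p (Fin.cons s d)
        then markSign s * (∏ v, markSign (d v)) *
          f (blockCount d + if s = 0 then 1 else 0) else 0 := by
  rw [markedSum, sum_fullCycles_succ]
  refine Finset.sum_congr rfl fun e _ => ?_
  have : ∀ g : (Fin (n + 1) → SignType) → ℤ,
      ∑ d, g d = ∑ d : Fin n → SignType, ∑ s, g (Fin.cons s d) := fun g => by
    rw [← (Fin.consEquiv fun _ => SignType).sum_comp, Fintype.sum_prod_type_right]
    rfl
  rw [Finset.sum_comm, this]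
  refine Finset.sum_congr rfl fun d _ => Finset.sum_congr rfl fun s _ =>
    Finset.sum_congr rfl fun q _ => ?_
  simp only [Fin.prod_univ_succ, Fin.cons_zero, Fin.cons_succ, blockCount_cons]

/-- A letter `0` in a block of its own can be inserted in front of the first letter of any block. -/
theorem markedSum_succ_startsUnmarked (n : ℕ) (f : ℕ → ℤ) :
    markedSum (n + 1) StartsUnmarked f =
      markedSum n (fun _ => True) fun m => m * f (m + 1) := by
  rw [markedSum_succ, markedSum]
  refine Finset.sum_congr rfl fun e _ => Finset.sum_congr rfl fun d _ => ?_
  rw [Finset.sum_eq_single 0 (fun s _ hs => by simp [startsUnmarked_cons, hs]) (by simp)]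
  simp only [follows_insertZero_cons_iff, startsUnmarked_cons, and_true]
  by_cases h : Follows e d
  · simp [h, ← Finset.sum_filter, card_avoids h, markSign]
    ring
  · simp [h]

/-- A letter `0` can be joined to the block of `1` on either side if that block is the letter `1`
alone, and on one side otherwise. -/
theorem markedSum_succ_not_startsUnmarked (n : ℕ) (f : ℕ → ℤ) :
    markedSum (n + 1) (fun d => ¬ StartsUnmarked d) f =
      -(2 * markedSum n StartsUnmarked f + markedSum n (fun d => ¬ StartsUnmarked d) f) := by
  rw [markedSum_succ]
  simp only [markedSum, Finset.mul_sum, ← Finset.sum_add_distrib, ← Finset.sum_neg_distrib]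
  refine Finset.sum_congr rfl fun e _ => Finset.sum_congr rfl fun d _ => ?_
  simp only [follows_insertZero_cons_iff, startsUnmarked_cons]
  have hs : ∀ g : SignType → ℤ, ∑ s, g s = g 0 + g (-1) + g 1 := fun g => by
    rw [show (Finset.univ : Finset SignType) = {0, -1, 1} from rfl]
    simp [add_assoc]
  by_cases h : Follows e d
  · have h1 := avoids_zero_add_avoids_apply_zero h
    have hq0 : ∀ (x : ℤ), (∑ q, if Avoids q d ∧ q = 0 then x else 0) =
        x * if Avoids 0 d then 1 else 0 := fun x => by
      rw [Finset.sum_eq_single 0] <;> simp +contextual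
    have hqe : ∀ (x : ℤ), (∑ q, if Avoids q d ∧ e 0 = q then x else 0) =
        x * if Avoids (e 0) d then 1 else 0 := fun x => by
      rw [Finset.sum_eq_single (e 0)] <;> simp +contextual [eq_comm]
    rw [hs]
    simp [h, hq0, hqe, markSign]
    generalize (∏ v, (if d v = 0 then (1 : ℤ) else -1)) * f (blockCount d) = y at *
    split_ifs at h1 ⊢ <;> simp_all
    ring
  · simp [h]

/-! ### Solution of the recursion by power series -/

open PowerSeries in
/-- The series `X (1 - X) / (1 + X) = X - 2 X ^ 2 + 2 X ^ 3 - ⋯` of signed markings of a single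
block: a block of `l ≥ 2` letters has two directions and `l - 1` marked pairs. -/
noncomputable def blockSeries : PowerSeries ℤ := X * ((1 - X) * invOneAddZ)

open PowerSeries in
theorem one_add_X_mul_blockSeries : (1 + X) * blockSeries = X * (1 - X) := by
  rw [blockSeries]
  linear_combination X * (1 - X) * one_add_X_mul_invOneAddZ

theorem X_pow_dvd_blockSeries_pow (m : ℕ) : PowerSeries.X ^ m ∣ blockSeries ^ m :=
  pow_dvd_pow_of_dvd (dvd_mul_right _ _) m

theorem X_pow_dvd_blockSeries_pow_succ_sub (m : ℕ) :
    PowerSeries.X ^ (m + 2) ∣ blockSeries ^ (m + 1) - PowerSeries.X * blockSeries ^ m := by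
  have h : blockSeries - PowerSeries.X = PowerSeries.X ^ 2 * (-2 * invOneAddZ) := by
    rw [blockSeries]
    linear_combination PowerSeries.X * one_add_X_mul_invOneAddZ
  have h : blockSeries ^ (m + 1) - PowerSeries.X * blockSeries ^ m =
      blockSeries ^ m * (PowerSeries.X ^ 2 * (-2 * invOneAddZ)) := by
    linear_combination blockSeries ^ m * h
  rw [h, pow_add]
  exact mul_dvd_mul (X_pow_dvd_blockSeries_pow m) (dvd_mul_right _ _)

theorem one_add_X_mul_blockSeries_pow_succ_sub (m : ℕ) :
    (1 + PowerSeries.X) * (blockSeries ^ (m + 1) - PowerSeries.X * blockSeries ^ m) =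
      -2 * (PowerSeries.X * (PowerSeries.X * blockSeries ^ m)) := by
  linear_combination blockSeries ^ m * one_add_X_mul_blockSeries

/-- The markings with `m + 1` blocks that some full cycle follows have signed count
`[X ^ (n + 1)] W ^ (m + 1)`, where `W` is `blockSeries`, and each is followed by `m!` full cycles.
A first block `{0}` contributes the factor `X`, a longer one the factor `W - X`. -/
theorem markedSum_startsUnmarked_and_not (n : ℕ) : ∀ f : ℕ → ℤ,
    markedSum n StartsUnmarked f = ∑ m ∈ Finset.range (n + 1),
      PowerSeries.coeff (n + 1) (PowerSeries.X * blockSeries ^ m) * (m.factorial * f (m + 1)) ∧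
    markedSum n (fun d => ¬ StartsUnmarked d) f = ∑ m ∈ Finset.range (n + 1),
      PowerSeries.coeff (n + 1) (blockSeries ^ (m + 1) - PowerSeries.X * blockSeries ^ m) *
        (m.factorial * f (m + 1)) := by
  induction n with
  | zero =>
    intro f
    have h := PowerSeries.X_pow_dvd_iff.1 (X_pow_dvd_blockSeries_pow_succ_sub 0) 1 (by norm_num)
    simp only [zero_add, pow_one, pow_zero, mul_one, map_sub,
      PowerSeries.coeff_one_X] at h
    simp [markedSum, fullCycles_one, StartsUnmarked, Follows, blockCount, h]
  | succ n ih =>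
    intro f
    constructor
    · rw [markedSum_succ_startsUnmarked, ← markedSum_add_not n StartsUnmarked,
        (ih _).1, (ih _).2, ← Finset.sum_add_distrib, Finset.sum_range_succ' _ (n + 1)]
      simp only [PowerSeries.coeff_succ_X_mul, pow_zero, PowerSeries.coeff_one, map_sub,
        Nat.succ_ne_zero, if_false, zero_mul, add_zero]
      refine Finset.sum_congr rfl fun m _ => ?_
      rw [Nat.factorial_succ]
      push_cast
      ring
    · rw [markedSum_succ_not_startsUnmarked, (ih _).1, (ih _).2, Finset.sum_range_succ _ (n + 1),
        PowerSeries.X_pow_dvd_iff.1 (X_pow_dvd_blockSeries_pow_succ_sub (n + 1)) _ (by omega),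
        zero_mul, add_zero, Finset.mul_sum, ← Finset.sum_add_distrib, ← Finset.sum_neg_distrib]
      refine Finset.sum_congr rfl fun m _ => ?_
      have h := congrArg (PowerSeries.coeff (n + 1 + 1)) (one_add_X_mul_blockSeries_pow_succ_sub m)
      rw [add_mul, one_mul, map_add, PowerSeries.coeff_succ_X_mul,
        show (-2 : PowerSeries ℤ) = PowerSeries.C (-2) by simp, PowerSeries.coeff_C_mul,
        PowerSeries.coeff_succ_X_mul] at h
      linear_combination (-(m.factorial * f (m + 1) : ℤ)) * h

theorem markedSum_true_one (n : ℕ) :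
    markedSum n (fun _ => True) (fun _ => 1) = ∑ m ∈ Finset.range (n + 1),
      m.factorial * PowerSeries.coeff (n + 1) (blockSeries ^ (m + 1)) := by
  rw [← markedSum_add_not n StartsUnmarked, (markedSum_startsUnmarked_and_not n _).1,
    (markedSum_startsUnmarked_and_not n _).2, ← Finset.sum_add_distrib]
  refine Finset.sum_congr rfl fun m _ => ?_
  rw [map_sub]
  ring

/-! ### The terms of the series -/

open PowerSeries in
theorem derivative_blockSeries :
    derivative ℤ blockSeries = (1 - 2 * X - X ^ 2) * invOneAddZ ^ 2 := by
  have h' := congrArg (derivative ℤ) one_add_X_mul_blockSeries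
  simp only [Derivation.leibniz, map_add, map_sub, derivative_X, Derivation.map_one_eq_zero,
    smul_eq_mul] at h'
  have hb : blockSeries = X * (1 - X) * invOneAddZ := by rw [blockSeries]; ring
  linear_combination invOneAddZ * h' - invOneAddZ * hb -
    (derivative ℤ blockSeries + (1 - 2 * X) * invOneAddZ) * one_add_X_mul_invOneAddZ

open PowerSeries in
/-- The derivative comes from the choice of the letter at which the cyclic word is cut. -/
theorem cylindricalKingTerm_succ (m : ℕ) :
    cylindricalKingTerm (m + 1) =
      (m.factorial : PowerSeries ℤ) * (X * derivative ℤ (blockSeries ^ (m + 1))) := by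
  rw [Derivation.leibniz_pow, derivative_blockSeries, cylindricalKingTerm, Nat.factorial_succ]
  simp only [Nat.add_sub_cancel, smul_eq_mul, nsmul_eq_mul, blockSeries, mul_pow]
  push_cast
  ring

theorem coeff_cylindricalKingTerm_succ (m n : ℕ) :
    PowerSeries.coeff n (cylindricalKingTerm (m + 1)) =
      n * (m.factorial * PowerSeries.coeff n (blockSeries ^ (m + 1))) := by
  rw [cylindricalKingTerm_succ, ← map_natCast (PowerSeries.C (R := ℤ)), PowerSeries.coeff_C_mul]
  cases n with
  | zero => simp
  | succ n =>
    rw [PowerSeries.coeff_succ_X_mul, PowerSeries.coeff_derivative]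
    push_cast
    ring

theorem hasSum_cylindricalKingTerm :
    HasSum (fun m : ℕ+ => cylindricalKingTerm (m : ℕ)) (PowerSeries.mk fun n =>
      n * ∑ m ∈ Finset.range n, m.factorial * PowerSeries.coeff n (blockSeries ^ (m + 1))) := by
  rw [← Equiv.pnatEquivNat.symm.hasSum_iff, PowerSeries.WithPiTopology.hasSum_iff_hasSum_coeff]
  intro n
  rw [PowerSeries.coeff_mk, Finset.mul_sum]
  simp only [Function.comp_def, Equiv.pnatEquivNat_symm_apply, Nat.succPNat_coe,
    Nat.succ_eq_add_one, coeff_cylindricalKingTerm_succ]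
  refine hasSum_sum_of_ne_finset_zero fun m hm => ?_
  rw [PowerSeries.X_pow_dvd_iff.1 (X_pow_dvd_blockSeries_pow (m + 1)) n
    (by simp at hm; omega), mul_zero, mul_zero]

/-! ### Cylindrical kings -/

theorem mem_cylindricalKings_iff {n : ℕ} (π : Equiv.Perm (Fin (n + 1))) :
    π ∈ cylindricalKings (n + 1) ↔ cyclicBondCount π = 0 := by
  have hlt : ∀ i j : Fin (n + 1), i ≠ j →
      (1 < |((π i).val : ℤ) - ((π j).val : ℤ)| ↔ |((π i).val : ℤ) - ((π j).val : ℤ)| ≠ 1) := by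
    intro i j hij
    have h : (π i).val ≠ (π j).val := fun h => hij (π.injective (Fin.ext h))
    have : 0 < |((π i).val : ℤ) - ((π j).val : ℤ)| := abs_pos.2 (by omega)
    omega
  simp only [cylindricalKings, cyclicBondCount, Finset.mem_filter, Finset.mem_univ, true_and,
    Finset.card_eq_zero, Finset.filter_eq_empty_iff, forall_true_left]
  constructor
  · rintro ⟨h1, h2⟩ i
    by_cases hi : i = Fin.last n
    · subst hi
      rw [finRotate_last]
      by_cases h0 : (0 : Fin (n + 1)) = Fin.last n
      · rw [← h0]; simp
      · rw [abs_sub_comm]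
        exact (hlt _ _ h0).1 (h2 0 (Fin.last n) rfl rfl h0)
    · have hi' : i.val < n := Fin.val_lt_last hi
      have hij : i.val + 1 = (finRotate (n + 1) i).val := (coe_finRotate_of_ne_last hi).symm
      exact (hlt _ _ (fun h => by rw [← h] at hij; omega)).1 (h1 _ _ hij)
  · intro h
    refine ⟨fun i j hij => ?_, fun i j hi hj hij => ?_⟩
    · have hi : i ≠ Fin.last n := fun hi => by simp [hi] at hij; omega
      have hj : finRotate (n + 1) i = j := Fin.ext (by rw [coe_finRotate_of_ne_last hi, hij])
      refine (hlt i j fun h' => by rw [h'] at hij; omega).2 ?_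
      rw [← hj]
      exact @h i
    · have h' := @h j
      rw [show j = Fin.last n from Fin.ext (by simpa using hj), finRotate_last,
        show (0 : Fin (n + 1)) = i from Fin.ext hi.symm, abs_sub_comm] at h'
      rw [hlt i j hij, show j = Fin.last n from Fin.ext (by simpa using hj)]
      exact h'

theorem cylindricalKingSeries_eq_map :
    cylindricalKingSeries =
      PowerSeries.map (Polynomial.evalRingHom (0 : ℤ)) cyclicBondSeries := by
  ext n
  rw [PowerSeries.coeff_map, cylindricalKingSeries, cyclicBondSeries, PowerSeries.coeff_mk,
    PowerSeries.coeff_mk]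
  cases n with
  | zero => simp
  | succ n =>
    rw [if_neg n.succ_ne_zero, if_neg n.succ_ne_zero, map_sum]
    simp only [Polynomial.coe_evalRingHom, Polynomial.eval_pow, Polynomial.eval_X, zero_pow_eq,
      ← mem_cylindricalKings_iff]
    simp

/-- The permutation `c`, read as the successor map of a cyclic word, never maps a letter to one that
differs from it by exactly one. -/
def IsBondFree {n : ℕ} (c : Equiv.Perm (Fin n)) : Prop :=
  ∀ x, |((c x).val : ℤ) - (x.val : ℤ)| ≠ 1

instance {n : ℕ} : DecidablePred fun c : Equiv.Perm (Fin n) => IsBondFree c := fun c => by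
  unfold IsBondFree; infer_instance

theorem mem_cylindricalKings_iff_isBondFree {n : ℕ} (π : Equiv.Perm (Fin (n + 1))) :
    π ∈ cylindricalKings (n + 1) ↔ IsBondFree (π * finRotate (n + 1) * π⁻¹) := by
  rw [mem_cylindricalKings_iff, cyclicBondCount, Finset.card_eq_zero, Finset.filter_eq_empty_iff,
    IsBondFree]
  refine π.forall_congr fun x => ?_
  simp [abs_sub_comm]

theorem card_cylindricalKings (n : ℕ) :
    ((cylindricalKings (n + 2)).card : ℤ) =
      (n + 2) * ∑ c ∈ fullCycles (n + 2), if IsBondFree c then 1 else 0 := by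
  rw [← sum_conj_finRotate fun c => if IsBondFree c then 1 else 0]
  simp only [← mem_cylindricalKings_iff_isBondFree]
  simp

/-- Expanding the product over the pairs `v, v + 1` chooses one of the three marks for each. -/
theorem sum_follows_eq_prod {n : ℕ} (c : Equiv.Perm (Fin (n + 1))) :
    (∑ d, if Follows c d then ∏ v, markSign (d v) else 0) =
      ∏ v : Fin n, (1 - (if c v.castSucc = v.succ then 1 else 0) -
        if c v.succ = v.castSucc then 1 else 0) := by
  have hs : ∀ v : Fin n, (1 - (if c v.castSucc = v.succ then 1 else 0) -
      (if c v.succ = v.castSucc then 1 else 0) : ℤ) = ∑ s : SignType,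
        if (s = 1 → c v.castSucc = v.succ) ∧ (s = -1 → c v.succ = v.castSucc) then
          markSign s else 0 := by
    intro v
    rw [show (Finset.univ : Finset SignType) = {0, -1, 1} from rfl]
    simp [markSign]
    split_ifs <;> simp
  simp only [hs, Finset.prod_univ_sum, Fintype.piFinset_univ]
  refine Finset.sum_congr rfl fun d _ => ?_
  rw [Finset.prod_ite_zero]
  simp [Follows]

/-- On at least three letters no two letters of a full cycle are successors of each other, so every
factor is `0` or `1`.  On two letters the only factor is `-1`. -/
theorem isBondFree_eq_prod {n : ℕ} {c : Equiv.Perm (Fin (n + 3))} (hc : IsFullCycle c) :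
    (if IsBondFree c then 1 else 0 : ℤ) =
      ∏ v : Fin (n + 2), (1 - (if c v.castSucc = v.succ then 1 else 0) -
        if c v.succ = v.castSucc then 1 else 0) := by
  have hnot : ∀ x y, c x = y → c y = x → False := by
    intro x y hx hy
    have hk : ∀ k : ℕ, (c ^ k) x = x ∨ (c ^ k) x = y := by
      intro k
      induction k with
      | zero => exact .inl rfl
      | succ k ih =>
        rw [pow_succ', Equiv.Perm.mul_apply]
        rcases ih with h | h <;> simp [h, hx, hy]
    have hz : ∀ z, z = x ∨ z = y := fun z => by
      obtain ⟨k, rfl⟩ := (hc x z).exists_nat_pow_eq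
      exact hk k
    have hcard : (Finset.univ : Finset (Fin (n + 3))) ⊆ {x, y} := fun z _ => by simpa using hz z
    have := (Finset.card_le_card hcard).trans Finset.card_le_two
    simp at this
  have hfree : IsBondFree c ↔
      ∀ v : Fin (n + 2), c v.castSucc ≠ v.succ ∧ c v.succ ≠ v.castSucc := by
    constructor
    · refine fun h v => ⟨fun hv => h v.castSucc ?_, fun hv => h v.succ ?_⟩ <;> simp [hv]
    · intro h x hx
      rcases (abs_eq zero_le_one).1 hx with hx | hx
      · have hlt : x.val < n + 2 := by omega
        exact (h ⟨x.val, hlt⟩).1 (Fin.ext (by simp; omega))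
      · have hlt : (c x).val < n + 2 := by omega
        refine (h ⟨(c x).val, hlt⟩).2 ?_
        rw [show Fin.succ ⟨(c x).val, hlt⟩ = x from Fin.ext (by simp; omega)]
        exact Fin.ext rfl
  by_cases h : IsBondFree c
  · rw [if_pos h, Finset.prod_eq_one]
    intro v _
    simp [(hfree.1 h v).1, (hfree.1 h v).2]
  · rw [if_neg h, eq_comm, Finset.prod_eq_zero_iff]
    rw [hfree] at h
    push Not at h
    obtain ⟨v, hv⟩ := h
    refine ⟨v, Finset.mem_univ _, ?_⟩
    by_cases h1 : c v.castSucc = v.succ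
    · have h2 : c v.succ ≠ v.castSucc := fun h2 => hnot _ _ h1 h2
      simp [h1, h2]
    · simp [h1, hv h1]

theorem card_cylindricalKings_add_three (n : ℕ) :
    ((cylindricalKings (n + 3)).card : ℤ) =
      (n + 3) * markedSum (n + 2) (fun _ => True) fun _ => 1 := by
  rw [card_cylindricalKings (n + 1), markedSum]
  push_cast
  rw [add_assoc]
  congr 1
  refine Finset.sum_congr rfl fun c hc => ?_
  simp only [and_true, mul_one, sum_follows_eq_prod, isBondFree_eq_prod (mem_fullCycles.1 hc)]

theorem markedSum_one_true_one : markedSum 1 (fun _ => True) (fun _ => 1) = -1 := by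
  rw [← markedSum_add_not 1 StartsUnmarked, markedSum_succ_startsUnmarked,
    markedSum_succ_not_startsUnmarked]
  simp [markedSum, fullCycles_one, StartsUnmarked, Follows, blockCount]

theorem mainTheorem8 :
    cylindricalKingSeries =
        PowerSeries.map (Polynomial.evalRingHom (0 : ℤ)) cyclicBondSeries ∧
      Summable (fun m : ℕ+ => cylindricalKingTerm (m : ℕ)) ∧
      cylindricalKingSeries =
        2 * PowerSeries.X ^ 2 + ∑' m : ℕ+, cylindricalKingTerm (m : ℕ) := by
  refine ⟨cylindricalKingSeries_eq_map, hasSum_cylindricalKingTerm.summable, ?_⟩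
  rw [hasSum_cylindricalKingTerm.tsum_eq]
  ext n
  rw [cylindricalKingSeries, map_add, PowerSeries.coeff_mk, PowerSeries.coeff_mk,
    show (2 : PowerSeries ℤ) = PowerSeries.C 2 by simp, PowerSeries.coeff_C_mul,
    PowerSeries.coeff_X_pow]
  match n with
  | 0 => simp
  | 1 =>
    rw [← markedSum_true_one 0, show (cylindricalKings 1).card = 1 by decide]
    simp [markedSum, fullCycles_one, Follows]
  | 2 =>
    -- The bond of the only full cycle is subtracted twice; the summand `2 * X ^ 2` corrects this.
    rw [← markedSum_true_one 1, markedSum_one_true_one,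
      show (cylindricalKings 2).card = 0 by decide]
    norm_num
  | n + 3 =>
    rw [← markedSum_true_one (n + 2), if_neg (by omega), if_neg (by omega),
      card_cylindricalKings_add_three]
    push_cast
    ring
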